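/- Let $0<\alpha<\pi/2$. A function $F:\mathbb Z^2\to\mathbb C$ is called discrete entire if \[ F(m+1,n+1)-F(m,n)=-i\big(F(m,n+1)-F(m+1,n)\big)\qquad\text{for all }(m,n)\in\mathbb Z^2 . \] For $t\in\mathbb R$, $t\not\equiv\pm\pi/2 \pmod{2\pi}$, let $e_t(m,n)=e^{itm}\Big(\frac{1+ie^{it}}{i+e^{it}}\Big)^n$ be the discrete exponential. Let $PW_\alpha$ be the space of all discrete entire functions $F:\mathbb Z^2\to\mathbb C$ such that (i) there is $c>0$ with $|F(m,n)|\le c\,|e_{-\alpha}(0,1)|^{|n|}$ for all $(m,n)\in\mathbb Z^2$, and (ii) $\sum_{m\in\mathbb Z}|F(m,0)|^2<+\infty$, endowed with the norm $\|F\|_{PW_\alpha}^2=\sum_{m\in\mathbb Z}|F(m,0)|^2$. **Theorem.** Let $\Lambda\subseteq\mathbb Z$ be such that $\Lambda\cap 2\mathbb Z=\{p_k\}_{k\in\mathbb Z}$ and $\Lambda\cap(2\mathbb Z+1)=\{q_k\}_{k\in\mathbb Z}$ for strictly increasing sequences $(p_k)_{k\in\mathbb Z}$ and $(q_k)_{k\in\mathbb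 Z}$ of integers (that is, both sets are unbounded above and below), and set \[ \delta_e=\sup_{k\in\mathbb Z}(p_{k+1}-p_k)\in(0,+\infty],\qquad \delta_o=\sup_{k\in\mathbb Z}(q_{k+1}-q_k)\in(0,+\infty]. \] If $\max(\delta_e,\delta_o)<\pi/\alpha$, then $\Lambda$ is a sampling set for $PW_\alpha$: there exists $c>0$ such that, for every $F\in PW_\alpha$, \[ c\,\|F\|^2_{PW_\alpha}\le\sum_{\lambda\in\Lambda}|F(\lambda,0)|^2\le\|F\|^2_{PW_\alpha}. \] -/

import Mathlib

namespace DiscretePW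

/-- `F` is discrete entire on the square lattice. -/
def IsDiscreteEntire (F : ℤ × ℤ → ℂ) : Prop :=
  ∀ m n : ℤ, F (m + 1, n + 1) - F (m, n) = -Complex.I * (F (m, n + 1) - F (m + 1, n))

/-- The discrete exponential `e_t(m, n) = e^{itm} ((1 + i e^{it}) / (i + e^{it}))^n`,
meaningful for `t ≠ ± π/2` modulo `2π`. -/
noncomputable def discreteExp (t : ℝ) (z : ℤ × ℤ) : ℂ :=
  Complex.exp (Complex.I * t * z.1) *
    ((1 + Complex.I * Complex.exp (Complex.I * t)) /
      (Complex.I + Complex.exp (Complex.I * t))) ^ z.2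

/-- The Paley--Wiener space `PW_α`: discrete entire functions of discrete exponential
growth which are square summable on the real line `n = 0`. -/
def PW (α : ℝ) : Set (ℤ × ℤ → ℂ) :=
  {F | IsDiscreteEntire F ∧
    (∃ c : ℝ, 0 < c ∧ ∀ m n : ℤ, ‖F (m, n)‖ ≤ c * ‖discreteExp (-α) (0, 1)‖ ^ n.natAbs) ∧
    Summable (fun m : ℤ => ‖F (m, 0)‖ ^ 2)}

/-- The norm of `PW_α`: the `ℓ²` norm at height zero. -/
noncomputable def pwNorm (F : ℤ × ℤ → ℂ) : ℝ :=
  Real.sqrt (∑' m : ℤ, ‖F (m, 0)‖ ^ 2)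

/-- `L` is a sampling set for `PW_α`, with upper constant one. -/
def IsSampling (α : ℝ) (L : Set ℤ) : Prop :=
  ∃ c : ℝ, 0 < c ∧ ∀ F ∈ PW α,
    Summable (fun l : L => ‖F ((l : ℤ), 0)‖ ^ 2) ∧
    c * pwNorm F ^ 2 ≤ ∑' l : L, ‖F ((l : ℤ), 0)‖ ^ 2 ∧
    ∑' l : L, ‖F ((l : ℤ), 0)‖ ^ 2 ≤ pwNorm F ^ 2

/-- `p` lists the elements of `S` in increasing order, indexed by all the integers. -/
def IsOrderedEnumeration (p : ℤ → ℤ) (S : Set ℤ) : Prop :=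
  StrictMono p ∧ Set.range p = S

/-- The maximal gap `sup_k (p_{k+1} - p_k)`, equal to `⊤` when the gaps are unbounded. -/
noncomputable def maxGap (p : ℤ → ℤ) : EReal :=
  ⨆ k : ℤ, (((p (k + 1) - p k : ℤ) : ℝ) : EReal)

end DiscretePW

/-! The two parity classes are treated separately. For `a j = F (2j + e, 0)`, a Bernstein inequality
with constant `4 sin² α` is played against a discrete Wirtinger inequality with constant `2 - 2 cos
θ`, up to a multiple of the samples. The gap condition leaves room for some `θ > 2α`, so `2 - 2 cos
θ > 4 sin² α`, and the difference is absorbed by the samples.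

Bernstein side: by discrete analyticity, `F` is the horizontal mean of its vertical mean. Two such
steps act on a parity class as `A = (S + 2 + S*)/4`, with `S` the shift, so `a = Aⁿ gₙ`, where `gₙ`
comes from `2n` vertical means. The growth condition gives `|gₙ| ≤ 2c (cos α)^(-2n)`. This forces
`⟪A a, a⟫ ≥ cos² α ‖a‖²` (`mul_norm_sq_le_re_inner_avgOp`), which is the Bernstein inequality. Since
`gₙ` is bounded but need not be square summable, spectral cutoffs are made from Bernstein
polynomials in `A`: these are contractions and have finite range, so `gₙ` can be truncated at only
polynomial cost.

Wirtinger side: comparison with the positive profile `sin (η + θ t)`, where `t` is the distance to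
the preceding sample (`wirtinger_of_distance`). -/

open Filter Topology
open scoped ENNReal InnerProductSpace ComplexOrder

namespace DiscretePW

local notation "ℓ2" => lp (fun _ : ℤ => ℂ) 2

/-! ### Bernstein polynomials of a positive contraction -/

section Bernstein

variable {H : Type*} [NormedAddCommGroup H] [InnerProductSpace ℂ H]

/-- The Bernstein polynomial `b_{N,k}` evaluated at an operator. -/
noncomputable def bernsteinOp (A : H →L[ℂ] H) (N k : ℕ) : H →L[ℂ] H :=
  Polynomial.aeval A (bernsteinPolynomial ℝ N k)

lemma bernsteinOp_eq (A : H →L[ℂ] H) (N k : ℕ) :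
    bernsteinOp A N k = (N.choose k : ℝ) • (A ^ k * (1 - A) ^ (N - k)) := by
  simp [bernsteinOp, bernsteinPolynomial, mul_assoc, Algebra.smul_def]

lemma bernsteinOp_apply (A : H →L[ℂ] H) (N k : ℕ) (x : H) :
    bernsteinOp A N k x = (N.choose k : ℂ) • (A ^ k * (1 - A) ^ (N - k)) x := by
  rw [bernsteinOp_eq, smul_apply, ← Complex.coe_smul, Complex.ofReal_natCast]

lemma bernsteinOp_nonneg [CompleteSpace H] {A : H →L[ℂ] H} (h0 : 0 ≤ A) (h1 : A ≤ 1) (N k : ℕ) :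
    0 ≤ bernsteinOp A N k := by
  rw [bernsteinOp_eq]
  refine smul_nonneg (by positivity) (Commute.mul_nonneg ?_ ?_ ?_)
  · exact CStarAlgebra.pow_nonneg h0 k
  · exact CStarAlgebra.pow_nonneg (sub_nonneg.2 h1) _
  · exact ((Commute.one_right A).sub_right (Commute.refl A)).pow_pow _ _

lemma sum_bernsteinOp (A : H →L[ℂ] H) (N : ℕ) :
    ∑ k ∈ Finset.range (N + 1), bernsteinOp A N k = 1 := by
  have := congrArg (Polynomial.aeval A) (bernsteinPolynomial.sum ℝ N)
  simpa [bernsteinOp, map_sum] using this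

lemma sum_natCast_smul_bernsteinOp (A : H →L[ℂ] H) (N : ℕ) :
    ∑ k ∈ Finset.range (N + 1), (k : ℝ) • bernsteinOp A N k = (N : ℝ) • A := by
  have := congrArg (Polynomial.aeval A) (bernsteinPolynomial.sum_smul ℝ N)
  simpa [bernsteinOp, map_sum, Algebra.smul_def] using this

/-- The operators `bernsteinOp A N k` are nonnegative and sum to the identity, so none exceeds it.
-/
lemma bernsteinOp_le_one [CompleteSpace H] {A : H →L[ℂ] H} (h0 : 0 ≤ A) (h1 : A ≤ 1) {N k : ℕ}
    (hk : k ≤ N) :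
    bernsteinOp A N k ≤ 1 := by
  rw [← sum_bernsteinOp A N]
  exact Finset.single_le_sum (f := fun k => bernsteinOp A N k)
    (fun k _ => bernsteinOp_nonneg h0 h1 N k) (by simp; omega)

lemma norm_bernsteinOp_le_one [CompleteSpace H] {A : H →L[ℂ] H} (h0 : 0 ≤ A) (h1 : A ≤ 1) {N k : ℕ}
    (hk : k ≤ N) : ‖bernsteinOp A N k‖ ≤ 1 :=
  (CStarAlgebra.norm_le_one_iff_of_nonneg _ (bernsteinOp_nonneg h0 h1 N k)).2
    (bernsteinOp_le_one h0 h1 hk)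

/-- The Bernstein approximation of `x ↦ max (c - x) 0` evaluated at an operator. -/
noncomputable def cutoffOp (A : H →L[ℂ] H) (c : ℝ) (N : ℕ) : H →L[ℂ] H :=
  ∑ k ∈ Finset.range (N + 1), max (c - k / N) 0 • bernsteinOp A N k

lemma cutoffOp_apply (A : H →L[ℂ] H) (c : ℝ) (N : ℕ) (x : H) :
    cutoffOp A c N x =
      ∑ k ∈ Finset.range (N + 1), ((max (c - k / N) 0 : ℝ) : ℂ) • bernsteinOp A N k x := by
  simp [cutoffOp]

/-- Bernstein approximation reproduces affine functions and preserves order, and `c - x ≤ max (c -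
x) 0`. -/
lemma sub_le_cutoffOp [CompleteSpace H] {A : H →L[ℂ] H} (h0 : 0 ≤ A) (h1 : A ≤ 1) (c : ℝ)
    {N : ℕ} (hN : N ≠ 0) :
    c • 1 - A ≤ cutoffOp A c N := by
  have h : c • 1 - A = ∑ k ∈ Finset.range (N + 1), (c - k / N) • bernsteinOp A N k := by
    simp_rw [sub_smul, Finset.sum_sub_distrib, ← Finset.smul_sum, sum_bernsteinOp, div_eq_inv_mul,
      mul_smul, ← Finset.smul_sum, sum_natCast_smul_bernsteinOp]
    rw [inv_smul_smul₀ (by exact_mod_cast hN)]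
  rw [h, cutoffOp]
  exact Finset.sum_le_sum fun k _ =>
    smul_le_smul_of_nonneg_right (le_max_left _ _) (bernsteinOp_nonneg h0 h1 N k)

lemma norm_cutoffOp_le [CompleteSpace H] {A : H →L[ℂ] H} (h0 : 0 ≤ A) (h1 : A ≤ 1) {c : ℝ}
    (hc : 0 ≤ c) (N : ℕ) :
    ‖cutoffOp A c N‖ ≤ c := by
  have hp : 0 ≤ cutoffOp A c N := Finset.sum_nonneg fun k _ =>
    smul_nonneg (le_max_right _ _) (bernsteinOp_nonneg h0 h1 N k)
  refine (CStarAlgebra.norm_le_iff_le_algebraMap _ hc hp).2 ?_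
  rw [Algebra.algebraMap_eq_smul_one, ← sum_bernsteinOp A N, Finset.smul_sum]
  refine Finset.sum_le_sum fun k _ =>
    smul_le_smul_of_nonneg_right (max_le ?_ hc) (bernsteinOp_nonneg h0 h1 N k)
  have : (0 : ℝ) ≤ k / N := by positivity
  linarith

lemma le_re_inner_add_of_le [CompleteSpace H] {A P : H →L[ℂ] H} {c : ℝ} (h : c • 1 - A ≤ P)
    (x : H) : c * ‖x‖ ^ 2 ≤ (⟪A x, x⟫_ℂ).re + (⟪P x, x⟫_ℂ).re := by
  have h := ((ContinuousLinearMap.le_def _ _).1 h).re_inner_nonneg_left x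
  have e : RCLike.re ⟪(c : ℂ) • x, x⟫_ℂ = c * ‖x‖ ^ 2 := by
    rw [inner_smul_left, Complex.conj_ofReal, RCLike.re_eq_complex_re, Complex.re_ofReal_mul,
      inner_self_eq_norm_sq_to_K]
    norm_cast
  simp only [sub_apply, smul_apply, inner_sub_left, one_apply_eq_self] at h
  rw [← Complex.coe_smul, map_sub, map_sub, e] at h
  simp only [RCLike.re_eq_complex_re] at h
  linarith

end Bernstein

/-! ### The shift and the averaging operator on `ℓ²(ℤ)` -/

section Shift

lemma summable_norm_sq (x : ℓ2) : Summable fun m => ‖x m‖ ^ 2 := by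
  have := (lp.memℓp x).summable (by norm_num)
  simpa using this

lemma norm_sq_eq_tsum (x : ℓ2) : ‖x‖ ^ 2 = ∑' m, ‖x m‖ ^ 2 := by
  have := lp.norm_rpow_eq_tsum (p := 2) (by norm_num) x
  simpa using this

lemma memℓp_two {f : ℤ → ℂ} (hf : Summable fun m => ‖f m‖ ^ 2) : Memℓp f 2 :=
  memℓp_gen (by simpa using hf)

/-- Translation by `d` on `ℓ²(ℤ)`. -/
noncomputable def translate (d : ℤ) : ℓ2 →ₗᵢ[ℂ] ℓ2 where
  toFun x := ⟨fun m => x (m + d),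
    memℓp_two ((Equiv.addRight d).summable_iff.2 (summable_norm_sq x))⟩
  map_add' x y := by ext m; rfl
  map_smul' c x := by ext m; rfl
  norm_map' x := by
    rw [← sq_eq_sq₀ (norm_nonneg _) (norm_nonneg _), norm_sq_eq_tsum, norm_sq_eq_tsum]
    exact (Equiv.addRight d).tsum_eq (fun m => ‖x m‖ ^ 2)

@[simp] lemma translate_apply (d : ℤ) (x : ℓ2) (m : ℤ) : translate d x m = x (m + d) := rfl

/-- The forward shift as a continuous operator. -/
noncomputable def shift : ℓ2 →L[ℂ] ℓ2 := (translate 1).toContinuousLinearMap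

@[simp] lemma shift_apply (x : ℓ2) (m : ℤ) : shift x m = x (m + 1) := rfl

lemma star_shift : star shift = (translate (-1)).toContinuousLinearMap := by
  rw [ContinuousLinearMap.star_eq_adjoint, eq_comm, ContinuousLinearMap.eq_adjoint_iff]
  intro x y
  rw [← (translate 1).inner_map_map]
  congr 1
  ext m
  simp

@[simp] lemma star_shift_apply (x : ℓ2) (m : ℤ) : star shift x m = x (m - 1) := by
  rw [star_shift]; rfl

/-- Half the sum of the identity and the shift. -/
noncomputable def halfSum : ℓ2 →L[ℂ] ℓ2 := (2⁻¹ : ℂ) • (1 + shift)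

/-- Half the difference of the identity and the shift. -/
noncomputable def halfDiff : ℓ2 →L[ℂ] ℓ2 := (2⁻¹ : ℂ) • (1 - shift)

/-- The averaging operator `x ↦ (x(m+1) + 2x(m) + x(m-1)) / 4`. -/
noncomputable def avgOp : ℓ2 →L[ℂ] ℓ2 := star halfSum * halfSum

lemma star_shift_mul_shift : star shift * shift = 1 := by
  ext x m
  simp

lemma avgOp_eq : avgOp = (4⁻¹ : ℂ) • (1 + 1 + shift + star shift) := by
  have : star (1 + shift) * (1 + shift) = 1 + 1 + shift + star shift := by
    simp only [star_add, star_one, add_mul, mul_add, one_mul, mul_one, star_shift_mul_shift]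
    abel
  rw [avgOp, halfSum, star_smul, smul_mul_smul_comm, this]
  congr 1
  norm_num

lemma avgOp_apply (x : ℓ2) (m : ℤ) : avgOp x m = (x (m + 1) + 2 * x m + x (m - 1)) / 4 := by
  rw [avgOp_eq]
  change (4⁻¹ : ℂ) * (x m + x m + shift x m + star shift x m) = _
  rw [shift_apply, star_shift_apply]
  ring

/-- With `halfSum` and `halfDiff` this is the parallelogram identity for the isometry `shift`. It
exhibits both `avgOp` and its complement as squares, whence `0 ≤ avgOp ≤ 1`. -/
lemma one_sub_avgOp : 1 - avgOp = star halfDiff * halfDiff := by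
  have : star (1 - shift) * (1 - shift) = 1 + 1 - shift - star shift := by
    simp only [star_sub, star_one, sub_mul, mul_sub, one_mul, mul_one, star_shift_mul_shift]
    abel
  rw [avgOp_eq, halfDiff, star_smul, smul_mul_smul_comm, this,
    show star (2⁻¹ : ℂ) * 2⁻¹ = 4⁻¹ by norm_num]
  module

lemma avgOp_nonneg : 0 ≤ avgOp := star_mul_self_nonneg _

lemma avgOp_le_one : avgOp ≤ 1 := by
  rw [← sub_nonneg, one_sub_avgOp]
  exact star_mul_self_nonneg _

lemma re_inner_avgOp (x : ℓ2) :
    (⟪avgOp x, x⟫_ℂ).re = ‖x‖ ^ 2 - 4⁻¹ * ∑' m, ‖x (m + 1) - x m‖ ^ 2 := by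
  have h : avgOp = 1 - star halfDiff * halfDiff := by
    rw [← one_sub_avgOp]; abel
  have h2 : ‖halfDiff x‖ ^ 2 = 4⁻¹ * ∑' m, ‖x (m + 1) - x m‖ ^ 2 := by
    rw [norm_sq_eq_tsum, ← tsum_mul_left]
    refine tsum_congr fun m => ?_
    rw [norm_sub_rev]
    change ‖(2⁻¹ : ℂ) * (x m - x (m + 1))‖ ^ 2 = _
    rw [norm_mul, mul_pow]
    norm_num
  have h3 : ⟪(star halfDiff * halfDiff) x, x⟫_ℂ = ((‖halfDiff x‖ ^ 2 : ℝ) : ℂ) := by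
    rw [mul_apply_eq_comp, ContinuousLinearMap.star_eq_adjoint,
      ContinuousLinearMap.adjoint_inner_left, inner_self_eq_norm_sq_to_K]
    simp
  rw [h, sub_apply, inner_sub_left, h3, Complex.sub_re, ← h2]
  congr 1
  rw [one_apply_eq_self, inner_self_eq_norm_sq_to_K]
  norm_cast

end Shift

/-! ### Locality of averages and pointwise bounds for Bernstein operators -/

section Averages

/-- The averaging operator on arbitrary sequences. -/
noncomputable def avgFun : Module.End ℂ (ℤ → ℂ) where
  toFun u m := (u (m + 1) + 2 * u m + u (m - 1)) / 4
  map_add' u v := by ext m; simp; ring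
  map_smul' c u := by ext m; simp; ring

lemma avgFun_apply (u : ℤ → ℂ) (m : ℤ) :
    avgFun u m = (u (m + 1) + 2 * u m + u (m - 1)) / 4 := rfl

lemma coe_avgOp (x : ℓ2) : (avgOp x : ℤ → ℂ) = avgFun x := funext fun m => avgOp_apply x m

lemma coe_pow_avgOp (x : ℓ2) (k : ℕ) : ((avgOp ^ k) x : ℤ → ℂ) = (avgFun ^ k) x := by
  induction k generalizing x with
  | zero => simp
  | succ k ih => rw [pow_succ, pow_succ, mul_apply_eq_comp, ih, coe_avgOp, Module.End.mul_apply]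

lemma coe_pow_one_sub_avgOp (x : ℓ2) (k : ℕ) :
    (((1 - avgOp) ^ k) x : ℤ → ℂ) = ((1 - avgFun) ^ k) x := by
  induction k generalizing x with
  | zero => simp
  | succ k ih =>
    rw [pow_succ, pow_succ, mul_apply_eq_comp, ih, Module.End.mul_apply, sub_apply,
      LinearMap.sub_apply, lp.coeFn_sub, coe_avgOp]
    rfl

lemma coe_monomial_avgOp (x : ℓ2) (k j : ℕ) :
    ((avgOp ^ k * (1 - avgOp) ^ j) x : ℤ → ℂ) = (avgFun ^ k * (1 - avgFun) ^ j) x := by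
  rw [mul_apply_eq_comp, coe_pow_avgOp, coe_pow_one_sub_avgOp, Module.End.mul_apply]

/-- The sequences `u` and `v` agree at distance at most `r` from `m`. -/
def AgreeNear (m : ℤ) (r : ℕ) (u v : ℤ → ℂ) : Prop := ∀ i, |i - m| ≤ r → u i = v i

lemma AgreeNear.mono {m : ℤ} {r s : ℕ} {u v : ℤ → ℂ} (h : AgreeNear m s u v) (hrs : r ≤ s) :
    AgreeNear m r u v := fun i hi => h i (hi.trans (by exact_mod_cast hrs))

lemma AgreeNear.avgFun {m : ℤ} {r : ℕ} {u v : ℤ → ℂ} (h : AgreeNear m (r + 1) u v) :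
    AgreeNear m r (avgFun u) (avgFun v) := by
  intro i hi
  rw [abs_le] at hi
  rw [avgFun_apply, avgFun_apply, h (i + 1) (by rw [abs_le]; push_cast; omega),
    h i (by rw [abs_le]; push_cast; omega), h (i - 1) (by rw [abs_le]; push_cast; omega)]

lemma AgreeNear.one_sub_avgFun {m : ℤ} {r : ℕ} {u v : ℤ → ℂ} (h : AgreeNear m (r + 1) u v) :
    AgreeNear m r ((1 - DiscretePW.avgFun) u) ((1 - DiscretePW.avgFun) v) := by
  intro i hi
  have h1 := h.avgFun i hi
  have h2 := h.mono (Nat.le_succ r) i hi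
  simp [h1, h2]

lemma AgreeNear.pow {T : Module.End ℂ (ℤ → ℂ)} {m : ℤ}
    (hT : ∀ {r : ℕ} {u v : ℤ → ℂ}, AgreeNear m (r + 1) u v → AgreeNear m r (T u) (T v))
    {r : ℕ} {u v : ℤ → ℂ} (k : ℕ) (h : AgreeNear m (r + k) u v) :
    AgreeNear m r ((T ^ k) u) ((T ^ k) v) := by
  induction k generalizing u v with
  | zero => simpa using h
  | succ k ih =>
    rw [pow_succ, Module.End.mul_apply, Module.End.mul_apply]
    exact ih (hT h)

lemma AgreeNear.monomial {m : ℤ} {r k j : ℕ} {u v : ℤ → ℂ} (h : AgreeNear m (r + k + j) u v) :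
    AgreeNear m r ((DiscretePW.avgFun ^ k * (1 - DiscretePW.avgFun) ^ j) u)
      ((DiscretePW.avgFun ^ k * (1 - DiscretePW.avgFun) ^ j) v) := by
  rw [Module.End.mul_apply, Module.End.mul_apply]
  exact AgreeNear.pow AgreeNear.avgFun k (AgreeNear.pow AgreeNear.one_sub_avgFun j h)

/-- A bounded sequence truncated to the window of radius `R` around `m`. -/
lemma exists_truncation (g : ℤ → ℂ) {M : ℝ} (hM : ∀ i, ‖g i‖ ≤ M) (m : ℤ) (R : ℕ) :
    ∃ x : ℓ2, AgreeNear m R g x ∧ ‖x‖ ≤ M * √(2 * R + 1) := by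
  have hM0 : 0 ≤ M := (norm_nonneg _).trans (hM 0)
  set s := Finset.Icc (m - R) (m + R) with hs
  have h0 : ∀ i ∉ s, ‖(if i ∈ s then g i else 0)‖ ^ 2 = 0 := fun i hi => by simp [hi]
  refine ⟨⟨fun i => if i ∈ s then g i else 0,
    memℓp_two (summable_of_ne_finset_zero (s := s) h0)⟩, ?_, ?_⟩
  · intro i hi
    rw [abs_le] at hi
    have : i ∈ s := by rw [hs, Finset.mem_Icc]; omega
    simp [this]
  · refine (sq_le_sq₀ (norm_nonneg _) (by positivity)).1 ?_
    rw [norm_sq_eq_tsum]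
    change ∑' i, ‖(if i ∈ s then g i else 0)‖ ^ 2 ≤ _
    rw [tsum_eq_sum h0, mul_pow, Real.sq_sqrt (by positivity)]
    have : ∀ i ∈ s, ‖(if i ∈ s then g i else 0)‖ ^ 2 ≤ M ^ 2 := fun i hi => by
      simp only [hi, if_true]
      gcongr
      exact hM i
    refine (Finset.sum_le_card_nsmul s _ _ this).trans (le_of_eq ?_)
    have hc : (s.card : ℝ) = 2 * R + 1 := by
      have : s.card = 2 * R + 1 := by rw [hs, Int.card_Icc]; omega
      rw [this]; push_cast; ring
    rw [nsmul_eq_mul, hc]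
    ring

/-- Moving `Aⁿ` inside turns `A^k (1 - A)^j Aⁿ g` into `A^(n+k) (1 - A)^j g`, which up to its
binomial coefficient is a Bernstein operator of degree `n + k + j`, a contraction. Its value at `m`
sees `g` only within that distance, so `g` may be truncated; the square root is that of the window
length. -/
lemma choose_mul_norm_monomial_le (x : ℓ2) (g : ℤ → ℂ) {M : ℝ} (hM : ∀ i, ‖g i‖ ≤ M) {n : ℕ}
    (hx : (x : ℤ → ℂ) = (avgFun ^ n) g) (k j : ℕ) (m : ℤ) :
    (n + k + j).choose (n + k) * ‖(avgOp ^ k * (1 - avgOp) ^ j) x m‖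
      ≤ M * √(2 * (n + k + j : ℕ) + 1) := by
  obtain ⟨y, hy, hyM⟩ := exists_truncation g hM m (n + k + j)
  have hcomm : Commute (avgFun ^ n) (avgFun ^ k * (1 - avgFun) ^ j) :=
    ((Commute.refl avgFun).pow_pow n k).mul_right
      (((Commute.one_right avgFun).sub_right (Commute.refl avgFun)).pow_pow n j)
  have h1 : (avgOp ^ k * (1 - avgOp) ^ j) x m
      = (avgOp ^ (n + k) * (1 - avgOp) ^ j) y m := by
    rw [coe_monomial_avgOp, coe_monomial_avgOp, hx, ← Module.End.mul_apply, ← hcomm.eq,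
      ← mul_assoc, ← pow_add]
    refine AgreeNear.monomial (m := m) (r := 0) ?_ m (by simp)
    simpa using hy
  have h2 : (n + k + j).choose (n + k) * ‖(avgOp ^ (n + k) * (1 - avgOp) ^ j) y m‖
      = ‖bernsteinOp avgOp (n + k + j) (n + k) y m‖ := by
    rw [bernsteinOp_apply, lp.coeFn_smul, Pi.smul_apply, norm_smul, Nat.add_sub_cancel_left]
    simp
  rw [h1, h2]
  calc _ ≤ ‖bernsteinOp avgOp (n + k + j) (n + k) y‖ := lp.norm_apply_le_norm (by norm_num) _ _
    _ ≤ 1 * ‖y‖ := (bernsteinOp avgOp (n + k + j) (n + k)).le_of_opNorm_le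
        (norm_bernsteinOp_le_one avgOp_nonneg avgOp_le_one (Nat.le_add_right _ _)) y
    _ ≤ _ := by rw [one_mul]; exact hyM

/-- Raising `N` and `k` together by one multiplies the binomial coefficient by `(N + i + 1) / (k + i
+ 1)`, and each of the `n` factors is at least `(N + n) / (k + n)` because `k ≤ N`. -/
lemma choose_mul_pow_le {N k : ℕ} (hk : k ≤ N) (n : ℕ) :
    N.choose k * (N + n) ^ n ≤ (N + n).choose (k + n) * (k + n) ^ n := by
  suffices h : ∀ i ≤ n, N.choose k * (N + n) ^ i ≤ (N + i).choose (k + i) * (k + n) ^ i from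
    h n le_rfl
  intro i hi
  induction i with
  | zero => simp
  | succ i ih =>
    have ih := ih (by omega)
    have h1 : (N + n) * (k + i + 1) ≤ (N + i + 1) * (k + n) := by
      obtain ⟨d, rfl⟩ := Nat.exists_eq_add_of_le hk
      obtain ⟨e, rfl⟩ := Nat.exists_eq_add_of_le hi
      nlinarith [Nat.zero_le (d * e)]
    have h2 := Nat.add_one_mul_choose_eq (N + i) (k + i)
    refine Nat.le_of_mul_le_mul_right (c := k + i + 1) ?_ (by omega)
    calc N.choose k * (N + n) ^ (i + 1) * (k + i + 1)
        = (N.choose k * (N + n) ^ i) * ((N + n) * (k + i + 1)) := by ring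
      _ ≤ ((N + i).choose (k + i) * (k + n) ^ i) * ((N + i + 1) * (k + n)) :=
          Nat.mul_le_mul ih h1
      _ = ((N + i + 1) * (N + i).choose (k + i)) * (k + n) ^ (i + 1) := by ring
      _ = _ := by rw [h2]; ring_nf

lemma norm_bernsteinOp_apply_le (x : ℓ2) (g : ℤ → ℂ) {M : ℝ} (hM : ∀ i, ‖g i‖ ≤ M) {n N k : ℕ}
    (hx : (x : ℤ → ℂ) = (avgFun ^ n) g) (hk : k ≤ N) (hN : 0 < N) (m : ℤ) :
    ‖bernsteinOp avgOp N k x m‖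
      ≤ M * (2 * (N + n : ℕ) + 1) * (((k + n : ℕ) : ℝ) / (N + n : ℕ)) ^ n := by
  have hM0 : 0 ≤ M := (norm_nonneg _).trans (hM 0)
  have h1 := choose_mul_norm_monomial_le x g hM hx k (N - k) m
  rw [show n + k + (N - k) = N + n by omega, show n + k = k + n by omega] at h1
  have h2 : (N.choose k : ℝ) * ((N + n : ℕ) : ℝ) ^ n
      ≤ (N + n).choose (k + n) * ((k + n : ℕ) : ℝ) ^ n := by exact_mod_cast choose_mul_pow_le hk n
  -- The square root is given away: any polynomial factor is harmless against the later geometric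
  -- decay.
  have h3 : √(2 * (N + n : ℕ) + 1 : ℝ) ≤ 2 * (N + n : ℕ) + 1 := by
    rw [Real.sqrt_le_left (by positivity)]
    have : (0 : ℝ) ≤ (N + n : ℕ) := by positivity
    nlinarith
  rw [bernsteinOp_apply, lp.coeFn_smul, Pi.smul_apply, norm_smul, Complex.norm_natCast, div_pow,
    ← mul_div_assoc, le_div_iff₀ (by positivity)]
  set t := ‖(avgOp ^ k * (1 - avgOp) ^ (N - k)) x m‖
  calc N.choose k * t * ((N + n : ℕ) : ℝ) ^ n = (N.choose k * ((N + n : ℕ) : ℝ) ^ n) * t := by ring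
    _ ≤ ((N + n).choose (k + n) * ((k + n : ℕ) : ℝ) ^ n) * t := by
        gcongr
    _ = ((N + n).choose (k + n) * t) * ((k + n : ℕ) : ℝ) ^ n := by ring
    _ ≤ _ := by
        exact mul_le_mul_of_nonneg_right
          (h1.trans (mul_le_mul_of_nonneg_left h3 hM0)) (by positivity)

/-! ### Weak limits of the cutoffs and the spectral lower bound -/

/-- Coordinatewise convergence handles finitely supported vectors; these are dense, and the uniform
bound controls the remainder. -/
lemma tendsto_inner_of_bounded {y : ℕ → ℓ2} {B : ℝ} (hB : ∀ n, ‖y n‖ ≤ B)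
    (hy : ∀ m, Tendsto (fun n => y n m) atTop (𝓝 0)) (x : ℓ2) :
    Tendsto (fun n => ⟪y n, x⟫_ℂ) atTop (𝓝 0) := by
  have hB0 : 0 ≤ B := (norm_nonneg _).trans (hB 0)
  have hfin : ∀ s : Finset ℤ,
      Tendsto (fun n => ⟪y n, ∑ i ∈ s, lp.single 2 i (x i)⟫_ℂ) atTop (𝓝 0) := by
    intro s
    simp_rw [inner_sum, lp.inner_single_right]
    have := tendsto_finsetSum s fun i _ => (hy i).inner (𝕜 := ℂ) (tendsto_const_nhds (x := x i))
    simpa only [inner_zero_left, Finset.sum_const_zero] using this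
  rw [Metric.tendsto_atTop]
  intro ε hε
  have hs := lp.hasSum_single (by norm_num) x
  obtain ⟨s, hs⟩ := ((Metric.tendsto_nhds.1 hs) (ε / (2 * (B + 1))) (by positivity)).exists
  obtain ⟨n₀, hn⟩ := (Metric.tendsto_atTop.1 (hfin s)) (ε / 2) (by positivity)
  refine ⟨n₀, fun n hn' => ?_⟩
  have h1 := hn n hn'
  rw [dist_zero_right] at h1 ⊢
  rw [dist_comm, dist_eq_norm] at hs
  have h2 : ⟪y n, x⟫_ℂ = ⟪y n, ∑ i ∈ s, lp.single 2 i (x i)⟫_ℂ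
      + ⟪y n, x - ∑ i ∈ s, lp.single 2 i (x i)⟫_ℂ := by rw [← inner_add_right]; simp
  have h3 : ‖⟪y n, x - ∑ i ∈ s, lp.single 2 i (x i)⟫_ℂ‖ ≤ (B + 1) * (ε / (2 * (B + 1))) :=
    (norm_inner_le_norm _ _).trans (mul_le_mul ((hB n).trans (by linarith)) hs.le
      (norm_nonneg _) (by positivity))
  have h4 : (B + 1) * (ε / (2 * (B + 1))) = ε / 2 := by field_simp
  rw [h2]
  linarith [norm_add_le ⟪y n, ∑ i ∈ s, lp.single 2 i (x i)⟫_ℂ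
    ⟪y n, x - ∑ i ∈ s, lp.single 2 i (x i)⟫_ℂ]

lemma tendsto_quadratic_mul_pow (R : ℝ) {q : ℝ} (hq0 : 0 ≤ q) (hq : q < 1) (C : ℝ) :
    Tendsto (fun n : ℕ => (R * n + 1) * (C * (2 * (R * n + n) + 1) * q ^ n)) atTop (𝓝 0) := by
  have h (k : ℕ) := tendsto_pow_const_mul_const_pow_of_abs_lt_one k (r := q)
    (by rwa [abs_of_nonneg hq0])
  have := (((h 2).const_mul (C * R * 2 * (R + 1))).add
    ((h 1).const_mul (C * (R + 2 * (R + 1))))).add ((h 0).const_mul C)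
  simp only [mul_zero, add_zero] at this
  refine this.congr fun n => ?_
  ring

/-- A square summable sequence that is an `n`-fold average of a sequence of size `O(σ⁻ⁿ)` has
spectrum of the averaging operator above `σ`. -/
theorem mul_norm_sq_le_re_inner_avgOp (x : ℓ2) {C σ : ℝ} (hσ : 0 < σ)
    (h : ∀ n : ℕ, ∃ g : ℤ → ℂ, (x : ℤ → ℂ) = (avgFun ^ n) g ∧ ∀ i, ‖g i‖ ≤ C * (σ⁻¹) ^ n) :
    σ * ‖x‖ ^ 2 ≤ (⟪avgOp x, x⟫_ℂ).re := by
  have hC : 0 ≤ C := by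
    obtain ⟨g, -, hg⟩ := h 0
    simpa using (norm_nonneg _).trans (hg 0)
  have key : ∀ c : ℝ, 0 ≤ c → c < σ → c * ‖x‖ ^ 2 ≤ (⟪avgOp x, x⟫_ℂ).re := by
    intro c hc0 hc
    -- The cutoff will have degree `N = R n`. Indices `k ≤ c N` give `(k + n) / (N + n) ≤ (c R + 1)
    -- / (R + 1)`, and `R` is taken so large that this stays below `σ`; `q` is the quotient of the
    -- two.
    obtain ⟨R, hR⟩ := exists_nat_gt (2 / (σ - c))
    have hR0 : (0 : ℝ) < R := lt_trans (div_pos two_pos (by linarith)) hR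
    have hRn : 0 < R := by exact_mod_cast hR0
    rw [div_lt_iff₀ (by linarith)] at hR
    set q : ℝ := (c * R + 1) / ((R + 1) * σ) with hq
    have hq0 : 0 ≤ q := by positivity
    have hq1 : q < 1 := by
      rw [hq, div_lt_one (by positivity)]
      nlinarith
    -- The index `n + 1` keeps the degree `R (n + 1)` nonzero.
    have hpt : ∀ (n : ℕ) (m : ℤ), ‖cutoffOp avgOp c (R * (n + 1)) x m‖
        ≤ (R * (n + 1 : ℕ) + 1) *
          (c * C * (2 * (R * (n + 1 : ℕ) + (n + 1 : ℕ)) + 1) * q ^ (n + 1)) := by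
      intro n' m
      obtain ⟨n, hn⟩ : ∃ n, n = n' + 1 := ⟨_, rfl⟩
      have hn0 : 0 < n := by omega
      rw [← hn]
      obtain ⟨g, hxg, hg⟩ := h n
      rw [cutoffOp_apply, lp.coeFn_sum, Finset.sum_apply]
      have hterm : ∀ k ∈ Finset.range (R * n + 1),
          ‖(((max (c - k / (R * n : ℕ)) 0 : ℝ) : ℂ) • bernsteinOp avgOp (R * n) k x : ℓ2) m‖
          ≤ c * C * (2 * (R * n + n) + 1) * q ^ n := by
        intro k hk
        have hkN : k ≤ R * n := by simpa [Nat.lt_succ_iff] using hk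
        rw [lp.coeFn_smul, Pi.smul_apply, norm_smul, Complex.norm_real, Real.norm_eq_abs,
          abs_of_nonneg (le_max_right _ _)]
        -- The cutoff weight vanishes unless `k < c N`. For the surviving terms `(q σ)ⁿ` beats the
        -- growth `σ⁻ⁿ` of `g`, leaving `qⁿ`.
        rcases le_or_gt (c - k / (R * n : ℕ)) 0 with hck | hck
        · rw [max_eq_right hck, zero_mul]
          positivity
        · rw [max_eq_left hck.le]
          have hNpos : (0 : ℝ) < (R * n : ℕ) := by exact_mod_cast Nat.mul_pos hRn hn0
          have hk' : (k : ℝ) ≤ c * (R * n) := by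
            have := (div_lt_iff₀ hNpos).1 (sub_pos.1 hck)
            push_cast at this
            exact this.le
          have hb := norm_bernsteinOp_apply_le x g hg hxg hkN (Nat.mul_pos hRn hn0) m
          have hn0' : (0 : ℝ) < n := by exact_mod_cast hn0
          have hratio : ((k + n : ℕ) : ℝ) / (R * n + n : ℕ) ≤ q * σ := by
            rw [hq, div_mul_eq_mul_div, mul_div_mul_right _ _ hσ.ne', div_le_div_iff₀
              (by positivity) (by positivity)]
            push_cast
            nlinarith
          calc (c - k / (R * n : ℕ)) * ‖bernsteinOp avgOp (R * n) k x m‖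
              ≤ c * (C * (σ⁻¹) ^ n * (2 * (R * n + n : ℕ) + 1) * (q * σ) ^ n) := by
                refine mul_le_mul ?_ (hb.trans ?_) (norm_nonneg _) hc0
                · have : (0 : ℝ) ≤ k / (R * n : ℕ) := by positivity
                  linarith
                · gcongr
            _ = _ := by
                rw [mul_pow, inv_pow]
                push_cast
                field_simp
      refine (norm_sum_le_of_le _ hterm).trans (le_of_eq ?_)
      rw [Finset.sum_const, Finset.card_range, nsmul_eq_mul]
      push_cast
      ring
    -- The cutoffs of `x` are bounded in norm and tend to zero at each point, hence weakly; in the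
    -- limit `c - A` has nonpositive quadratic form at `x`.
    have hlim := tendsto_inner_of_bounded (y := fun n => cutoffOp avgOp c (R * (n + 1)) x)
      (B := c * ‖x‖)
      (fun n => ContinuousLinearMap.le_of_opNorm_le _
        (norm_cutoffOp_le avgOp_nonneg avgOp_le_one hc0 _) x)
      (fun m => squeeze_zero_norm (fun n => hpt n m)
        ((tendsto_quadratic_mul_pow R hq0 hq1 (c * C)).comp (tendsto_add_atTop_nat 1))) x
    have hlim2 := (Complex.continuous_re.tendsto _).comp hlim
    have hlim3 : Tendsto (fun n : ℕ => (⟪avgOp x, x⟫_ℂ).re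
        + (⟪cutoffOp avgOp c (R * (n + 1)) x, x⟫_ℂ).re) atTop (𝓝 (⟪avgOp x, x⟫_ℂ).re) := by
      simpa using hlim2.const_add (⟪avgOp x, x⟫_ℂ).re
    refine ge_of_tendsto' hlim3 fun n => ?_
    exact le_re_inner_add_of_le
      (sub_le_cutoffOp avgOp_nonneg avgOp_le_one c (Nat.mul_pos hRn n.succ_pos).ne') x
  have hcont : Tendsto (fun c : ℝ => c * ‖x‖ ^ 2) (𝓝[<] σ) (𝓝 (σ * ‖x‖ ^ 2)) :=
    ((continuous_id.mul continuous_const).tendsto σ).mono_left nhdsWithin_le_nhds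
  refine le_of_tendsto hcont ?_
  filter_upwards [Ioo_mem_nhdsLT hσ] with c hc using key c hc.1.le hc.2

theorem tsum_norm_sq_sub_le (a : ℤ → ℂ) (ha : Summable fun j => ‖a j‖ ^ 2) {C σ : ℝ} (hσ : 0 < σ)
    (h : ∀ n : ℕ, ∃ g : ℤ → ℂ, a = (avgFun ^ n) g ∧ ∀ i, ‖g i‖ ≤ C * (σ⁻¹) ^ n) :
    ∑' j, ‖a (j + 1) - a j‖ ^ 2 ≤ 4 * (1 - σ) * ∑' j, ‖a j‖ ^ 2 := by
  have h1 := mul_norm_sq_le_re_inner_avgOp ⟨a, memℓp_two ha⟩ hσ h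
  rw [re_inner_avgOp, norm_sq_eq_tsum] at h1
  change σ * ∑' j, ‖a j‖ ^ 2 ≤ ∑' j, ‖a j‖ ^ 2 - 4⁻¹ * ∑' j, ‖a (j + 1) - a j‖ ^ 2 at h1
  linarith

end Averages

/-! ### Vertical means of discrete entire functions and the Bernstein inequality -/

section DiscreteEntire

/-- The mean of the two vertical neighbours. -/
noncomputable def verticalMean (F : ℤ × ℤ → ℂ) (z : ℤ × ℤ) : ℂ :=
  (F (z.1, z.2 + 1) + F (z.1, z.2 - 1)) / 2

lemma IsDiscreteEntire.verticalMean {F : ℤ × ℤ → ℂ} (hF : IsDiscreteEntire F) :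
    IsDiscreteEntire (verticalMean F) := by
  intro m n
  have h1 := hF m (n + 1)
  have h2 := hF m (n - 1)
  rw [show n - 1 + 1 = n by ring] at h2
  simp only [DiscretePW.verticalMean, show n + 1 - 1 = n by ring]
  linear_combination (h1 + h2) / 2

/-- Combining the equations on the four unit squares around `(m, n)` shows that `F (m, n)` is the
mean of its four diagonal neighbours. -/
lemma IsDiscreteEntire.horizontalMean_verticalMean {F : ℤ × ℤ → ℂ} (hF : IsDiscreteEntire F)
    (m n : ℤ) :
    (DiscretePW.verticalMean F (m + 1, n) + DiscretePW.verticalMean F (m - 1, n)) / 2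
      = F (m, n) := by
  have h1 := hF m n
  have h2 := hF (m - 1) n
  have h3 := hF m (n - 1)
  have h4 := hF (m - 1) (n - 1)
  simp only [show m - 1 + 1 = m by ring, show n - 1 + 1 = n by ring] at h1 h2 h3 h4
  simp only [DiscretePW.verticalMean]
  linear_combination (h1 - Complex.I * h2 + Complex.I * h3 - h4
    + (F (m - 1, n + 1) - 2 * F (m, n) + F (m + 1, n - 1)) * Complex.I_sq) / 4

lemma IsDiscreteEntire.iterate_verticalMean {F : ℤ × ℤ → ℂ} (hF : IsDiscreteEntire F) (k : ℕ) :
    IsDiscreteEntire (DiscretePW.verticalMean^[k] F) := by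
  induction k with
  | zero => exact hF
  | succ k ih => rw [Function.iterate_succ_apply']; exact ih.verticalMean

/-- The majorant `ρⁿ + ρ⁻ⁿ` is an eigenfunction of the vertical mean with eigenvalue `(ρ + ρ⁻¹) /
2`. -/
lemma norm_iterate_verticalMean_le {F : ℤ × ℤ → ℂ} {c ρ : ℝ} (hρ : 0 < ρ)
    (hF : ∀ m n : ℤ, ‖F (m, n)‖ ≤ c * (ρ ^ n + ρ ^ (-n))) (k : ℕ) (m n : ℤ) :
    ‖verticalMean^[k] F (m, n)‖ ≤ c * ((ρ + ρ⁻¹) / 2) ^ k * (ρ ^ n + ρ ^ (-n)) := by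
  induction k generalizing m n with
  | zero => simpa using hF m n
  | succ k ih =>
    rw [Function.iterate_succ_apply', verticalMean, norm_div, Complex.norm_ofNat]
    refine (div_le_div_of_nonneg_right ((norm_add_le _ _).trans
      (add_le_add (ih m (n + 1)) (ih m (n - 1)))) zero_le_two).trans (le_of_eq ?_)
    have h := hρ.ne'
    rw [show -(n + 1) = -n - 1 by ring, show -(n - 1) = -n + 1 by ring, zpow_add_one₀ h,
      zpow_add_one₀ h, zpow_sub_one₀ h, zpow_sub_one₀ h]
    ring

/-- The square of the horizontal mean has step two and weights `1/4, 1/2, 1/4`, so it preserves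
parity and is `avgFun` on each class. -/
lemma avgFun_verticalMean {F : ℤ × ℤ → ℂ} (hF : IsDiscreteEntire F) (e : ℤ) :
    avgFun (fun j => verticalMean (verticalMean F) (2 * j + e, 0)) = fun j => F (2 * j + e, 0) := by
  ext j
  rw [avgFun_apply, ← hF.horizontalMean_verticalMean, ← hF.verticalMean.horizontalMean_verticalMean,
    ← hF.verticalMean.horizontalMean_verticalMean]
  rw [show 2 * (j + 1) + e = 2 * j + e + 1 + 1 by ring,
    show 2 * (j - 1) + e = 2 * j + e - 1 - 1 by ring,
    show 2 * j + e + 1 - 1 = 2 * j + e by ring, show 2 * j + e - 1 + 1 = 2 * j + e by ring]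
  ring

lemma pow_avgFun_verticalMean {F : ℤ × ℤ → ℂ} (hF : IsDiscreteEntire F) (e : ℤ) (n : ℕ) :
    (avgFun ^ n) (fun j => verticalMean^[2 * n] F (2 * j + e, 0)) = fun j => F (2 * j + e, 0) := by
  induction n with
  | zero => simp
  | succ n ih =>
    rw [pow_succ, Module.End.mul_apply]
    simp only [show 2 * (n + 1) = 2 * n + 1 + 1 by ring, Function.iterate_succ_apply' verticalMean]
    rw [avgFun_verticalMean (hF.iterate_verticalMean (2 * n)), ih]

lemma norm_discreteExp_neg {α : ℝ} (hα0 : 0 < α) (hα : α < Real.pi / 2) :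
    ‖discreteExp (-α) (0, 1)‖ = (1 + Real.sin α) / Real.cos α := by
  have hc : 0 < Real.cos α := Real.cos_pos_of_mem_Ioo ⟨by linarith, hα⟩
  have hs : 0 < Real.sin α := Real.sin_pos_of_pos_of_lt_pi hα0 (by linarith [Real.pi_pos])
  have hcC : (Real.cos α : ℂ) ≠ 0 := by exact_mod_cast hc.ne'
  have hsq : (Real.sin α : ℂ) ^ 2 + (Real.cos α : ℂ) ^ 2 = 1 := by
    exact_mod_cast Real.sin_sq_add_cos_sq α
  have hexp : Complex.exp (Complex.I * ((-α : ℝ) : ℂ))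
      = Real.cos α - Complex.I * Real.sin α := by
    rw [mul_comm, Complex.exp_mul_I, ← Complex.ofReal_cos, ← Complex.ofReal_sin, Real.cos_neg,
      Real.sin_neg]
    push_cast
    ring
  have hne : Complex.I + Complex.exp (Complex.I * ((-α : ℝ) : ℂ)) ≠ 0 := by
    rw [hexp]
    intro h
    have := congrArg Complex.re h
    simp at this
    rw [← Complex.ofReal_cos, Complex.ofReal_re] at this
    exact hc.ne' this
  have h : discreteExp (-α) (0, 1) = (((1 + Real.sin α) / Real.cos α : ℝ) : ℂ) := by
    have h0 : discreteExp (-α) (0, 1) = (1 + Complex.I * Complex.exp (Complex.I * ((-α : ℝ) : ℂ))) /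
        (Complex.I + Complex.exp (Complex.I * ((-α : ℝ) : ℂ))) := by
      simp [discreteExp]
    rw [h0, div_eq_iff hne, hexp, Complex.ofReal_div, div_mul_eq_mul_div, eq_div_iff hcC]
    push_cast only [Complex.ofReal_add, Complex.ofReal_one]
    linear_combination Complex.I * hsq - Real.sin α * Real.cos α * Complex.I_sq
  rw [h, Complex.norm_real, Real.norm_of_nonneg (by positivity)]

/-- Bernstein's inequality for the restrictions of a Paley--Wiener function to the two parity
classes of the real line. -/
theorem tsum_norm_sq_sub_le_of_mem_PW {α : ℝ} (hα0 : 0 < α) (hα : α < Real.pi / 2)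
    {F : ℤ × ℤ → ℂ} (hF : F ∈ PW α) (e : ℤ)
    (hs : Summable fun j : ℤ => ‖F (2 * j + e, 0)‖ ^ 2) :
    ∑' j : ℤ, ‖F (2 * (j + 1) + e, 0) - F (2 * j + e, 0)‖ ^ 2
      ≤ 4 * Real.sin α ^ 2 * ∑' j : ℤ, ‖F (2 * j + e, 0)‖ ^ 2 := by
  obtain ⟨hE, ⟨c, hc0, hc⟩, -⟩ := hF
  rw [norm_discreteExp_neg hα0 hα] at hc
  have hcos : 0 < Real.cos α := Real.cos_pos_of_mem_Ioo ⟨by linarith, hα⟩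
  have hsin : 0 < Real.sin α := Real.sin_pos_of_pos_of_lt_pi hα0 (by linarith [Real.pi_pos])
  set ρ := (1 + Real.sin α) / Real.cos α with hρ
  have hρ0 : 0 < ρ := by positivity
  -- Here `ρ⁻¹ = (1 - sin α) / cos α`.
  have hmean : (ρ + ρ⁻¹) / 2 = (Real.cos α)⁻¹ := by
    rw [hρ]
    have := Real.sin_sq_add_cos_sq α
    field_simp
    nlinarith
  have hgrowth : ∀ m n : ℤ, ‖F (m, n)‖ ≤ c * (ρ ^ n + ρ ^ (-n)) := by
    intro m n
    refine (hc m n).trans ?_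
    have h1 : 0 < ρ ^ n := zpow_pos hρ0 n
    have h2 : 0 < ρ ^ (-n) := zpow_pos hρ0 (-n)
    gcongr
    rw [← zpow_natCast, Int.natCast_natAbs]
    rcases abs_choice n with h | h <;> rw [h] <;> linarith
  -- Each averaging costs two vertical means, hence `σ = cos² α`; the factor `2` in `2 * c` is the
  -- majorant `ρⁿ + ρ⁻ⁿ` at height zero.
  have h := tsum_norm_sq_sub_le (fun j => F (2 * j + e, 0)) hs (C := 2 * c)
    (σ := Real.cos α ^ 2) (by positivity) fun n =>
      ⟨_, (pow_avgFun_verticalMean hE e n).symm, fun i => by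
        refine (norm_iterate_verticalMean_le hρ0 hgrowth (2 * n) _ 0).trans (le_of_eq ?_)
        rw [hmean, pow_mul, ← inv_pow]
        norm_num
        ring⟩
  rwa [Real.sin_sq]

end DiscreteEntire

/-! ### The discrete Wirtinger inequality and the sample gaps -/

section Gaps

/-- Weighted AM-GM: `2‖x‖‖y‖ ≤ r‖x‖² + r⁻¹‖y‖²`. -/
lemma norm_sub_sq_ge (x y : ℂ) {r : ℝ} (hr : 0 < r) :
    (1 - r) * ‖x‖ ^ 2 + (1 - r⁻¹) * ‖y‖ ^ 2 ≤ ‖y - x‖ ^ 2 := by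
  have h1 : (‖y‖ - ‖x‖) ^ 2 ≤ ‖y - x‖ ^ 2 := by
    rw [← sq_abs]
    gcongr
    exact abs_norm_sub_norm_le y x
  have h2 : 0 ≤ r⁻¹ * (r * ‖x‖ - ‖y‖) ^ 2 := by positivity
  have h3 : r⁻¹ * (r * ‖x‖ - ‖y‖) ^ 2 = r * ‖x‖ ^ 2 - 2 * ‖x‖ * ‖y‖ + r⁻¹ * ‖y‖ ^ 2 := by
    field_simp
    ring
  nlinarith

/-- A discrete Wirtinger inequality for sequences sampled on `J`, where `t j` measures the distance
from `j` down to the preceding sampling point. -/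
theorem wirtinger_of_distance {J : Set ℤ} {t : ℤ → ℕ} {θ η Γ : ℝ} (hη : 0 < η) (hθ : 0 < θ)
    (hπ : 2 * η + θ * Γ ≤ Real.pi) (ht : ∀ j, (t j + 1 : ℝ) ≤ Γ)
    (hJ : ∀ j ∉ J, t j = t (j - 1) + 1) (a : ℤ → ℂ) (ha : Summable fun j => ‖a j‖ ^ 2) :
    (2 - 2 * Real.cos θ) * ∑' j, ‖a j‖ ^ 2 ≤ ∑' j, ‖a (j + 1) - a j‖ ^ 2
      + (4 + 2 * (Real.sin η)⁻¹) * ∑' j, J.indicator (fun j => ‖a j‖ ^ 2) j := by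
  set w : ℝ → ℝ := fun i => Real.sin (η + θ * i) with hw
  have hΓ0 : 0 ≤ Γ := le_trans (by positivity) (ht 0)
  have hηπ : η ≤ Real.pi / 2 := by nlinarith
  have hs : 0 < Real.sin η := Real.sin_pos_of_pos_of_lt_pi hη (by linarith [Real.pi_pos])
  -- By `hπ` the angle stays in `[η, π - η]`, so the profile never falls below `sin η`.
  have hwlow : ∀ i : ℝ, 0 ≤ i → i ≤ Γ → Real.sin η ≤ w i := by
    intro i hi0 hi
    have h1 : 0 ≤ θ * i := by positivity
    have h2 : θ * i ≤ θ * Γ := by gcongr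
    rcases le_total (η + θ * i) (Real.pi / 2) with h | h
    · exact Real.sin_le_sin_of_le_of_le_pi_div_two (by linarith) h (by linarith)
    · change Real.sin η ≤ Real.sin (η + θ * i)
      rw [← Real.sin_pi_sub (η + θ * i)]
      exact Real.sin_le_sin_of_le_of_le_pi_div_two (by linarith) (by linarith) (by linarith)
  have hwup : ∀ i, w i ≤ 1 := fun i => Real.sin_le_one _
  have hlow0 : ∀ j, Real.sin η ≤ w (t j) := fun j =>
    hwlow _ (by positivity) (by linarith [ht j])
  have hlow1 : ∀ j, Real.sin η ≤ w (t j + 1) := fun j => hwlow _ (by positivity) (ht j)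
  set r : ℤ → ℝ := fun j => w (t j + 1) / w (t j) with hr
  have hr0 : ∀ j, 0 < r j := fun j => div_pos (hs.trans_le (hlow1 j)) (hs.trans_le (hlow0 j))
  have hrle : ∀ j, r j ≤ (Real.sin η)⁻¹ := fun j => by
    rw [← one_div]
    exact div_le_div₀ zero_le_one (hwup _) hs (hlow0 j)
  have hrinv : ∀ j, (r j)⁻¹ ≤ (Real.sin η)⁻¹ := fun j => by
    rw [hr, inv_div, ← one_div]
    exact div_le_div₀ zero_le_one (hwup _) hs (hlow1 j)
  have hsh : Summable fun j => ‖a (j + 1)‖ ^ 2 := (Equiv.addRight (1 : ℤ)).summable_iff.2 ha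
  have hΔ : Summable fun j => ‖a (j + 1) - a j‖ ^ 2 := by
    refine Summable.of_nonneg_of_le (fun _ => by positivity) (fun j => ?_)
      ((hsh.add ha).mul_left 2)
    have := norm_sub_le (a (j + 1)) (a j)
    nlinarith [norm_nonneg (a (j + 1) - a j), sq_nonneg (‖a (j + 1)‖ - ‖a j‖)]
  have hR : Summable fun j => r j * ‖a j‖ ^ 2 :=
    Summable.of_nonneg_of_le (fun j => mul_nonneg (hr0 j).le (by positivity))
      (fun j => mul_le_mul_of_nonneg_right (hrle j) (by positivity)) (ha.mul_left _)
  have hR' : Summable fun j => (r (j - 1))⁻¹ * ‖a j‖ ^ 2 :=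
    Summable.of_nonneg_of_le (fun j => mul_nonneg (inv_pos.2 (hr0 _)).le (by positivity))
      (fun j => mul_le_mul_of_nonneg_right (hrinv _) (by positivity)) (ha.mul_left _)
  have h1 : Summable fun j => (1 - r j) * ‖a j‖ ^ 2 := by
    simpa [sub_mul] using ha.sub hR
  have h2 : Summable fun j => (1 - (r (j - 1))⁻¹) * ‖a j‖ ^ 2 := by
    simpa [sub_mul] using ha.sub hR'
  have h2s : ∑' j, (1 - (r (j - 1))⁻¹) * ‖a j‖ ^ 2 = ∑' j, (1 - (r j)⁻¹) * ‖a (j + 1)‖ ^ 2 := by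
    rw [← (Equiv.addRight (1 : ℤ)).tsum_eq]
    simp
  have h2' : Summable fun j => (1 - (r j)⁻¹) * ‖a (j + 1)‖ ^ 2 := by
    have := (Equiv.addRight (1 : ℤ)).summable_iff.2 h2
    simpa [Function.comp_def] using this
  -- Each edge is bounded below with the ratio of the profile along it as weight; regrouping by
  -- vertices, `j` collects `2 - r j - (r (j - 1))⁻¹`.
  have hedge : ∑' j, (1 - r j) * ‖a j‖ ^ 2 + ∑' j, (1 - (r (j - 1))⁻¹) * ‖a j‖ ^ 2
      ≤ ∑' j, ‖a (j + 1) - a j‖ ^ 2 := by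
    rw [h2s, ← h1.tsum_add h2']
    exact (h1.add h2').tsum_le_tsum (fun j => norm_sub_sq_ge (a j) (a (j + 1)) (hr0 j)) hΔ
  have hind : Summable (J.indicator fun j => ‖a j‖ ^ 2) := ha.indicator J
  have hpoint : ∀ j, (2 - 2 * Real.cos θ) * ‖a j‖ ^ 2 ≤ ((1 - r j) * ‖a j‖ ^ 2
      + (1 - (r (j - 1))⁻¹) * ‖a j‖ ^ 2)
      + (4 + 2 * (Real.sin η)⁻¹) * J.indicator (fun j => ‖a j‖ ^ 2) j := by
    intro j
    -- At a sample the profile restarts and the ratios are only bounded, by `1 / sin η`; the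
    -- constant `4 + 2 / sin η` pays for this. Elsewhere `w` continues from `j - 1`, and its
    -- recurrence `w(t+1) + w(t-1) = 2 cos θ w(t)` gives equality.
    by_cases hj : j ∈ J
    · rw [Set.indicator_of_mem hj]
      have := hrle j
      have := hrinv (j - 1)
      have := Real.neg_one_le_cos θ
      have h0 : 0 ≤ ‖a j‖ ^ 2 := by positivity
      rw [← add_mul, ← add_mul]
      gcongr
      linarith
    · rw [Set.indicator_of_notMem hj, mul_zero, add_zero, ← add_mul]
      refine le_of_eq ?_
      congr 1
      have hpos : w (t j) ≠ 0 := (hs.trans_le (hlow0 j)).ne'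
      have htj : (t j : ℝ) = t (j - 1) + 1 := by rw [hJ j hj]; push_cast; rfl
      have hsum : w (t j + 1) + w (t (j - 1)) = 2 * Real.cos θ * w (t j) := by
        have e : (t (j - 1) : ℝ) = t j - 1 := by linarith
        simp only [hw, e]
        rw [show η + θ * (t j + 1) = (η + θ * t j) + θ by ring,
          show η + θ * (t j - 1) = (η + θ * t j) - θ by ring, Real.sin_add, Real.sin_sub]
        ring
      have hrr : r j + (r (j - 1))⁻¹ = 2 * Real.cos θ := by
        simp only [hr, inv_div]
        rw [← htj, ← add_div, hsum, mul_div_assoc, div_self hpos, mul_one]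
      linarith
  have := (ha.mul_left (2 - 2 * Real.cos θ)).tsum_le_tsum hpoint
    ((h1.add h2).add (hind.mul_left _))
  rw [tsum_mul_left, (h1.add h2).tsum_add (hind.mul_left _), h1.tsum_add h2, tsum_mul_left] at this
  linarith

/-- The distance to the nearest sample at or below `j` works: off `J` the search passes on to `j -
1`. -/
lemma exists_distance {J : Set ℤ} {Γ : ℝ} (h : ∀ j : ℤ, ∃ k : ℕ, j - k ∈ J ∧ (k + 1 : ℝ) ≤ Γ) :
    ∃ t : ℤ → ℕ, (∀ j, (t j + 1 : ℝ) ≤ Γ) ∧ ∀ j ∉ J, t j = t (j - 1) + 1 := by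
  classical
  have hex : ∀ j : ℤ, ∃ k : ℕ, j - k ∈ J := fun j => (h j).imp fun _ => And.left
  refine ⟨fun j => Nat.find (hex j), fun j => ?_, fun j hj => ?_⟩
  · obtain ⟨k, hk, hkΓ⟩ := h j
    have : (Nat.find (hex j) : ℝ) ≤ k := by exact_mod_cast Nat.find_min' (hex j) hk
    linarith
  · have e : ∀ n : ℕ, j - (n + 1 : ℕ) = j - 1 - n := fun n => by push_cast; ring
    have h2 : ∃ n : ℕ, j - (n + 1 : ℕ) ∈ J := by simpa only [e] using hex (j - 1)
    refine (Nat.find_comp_succ (hex j) h2 (by simpa using hj)).trans ?_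
    simp only [e]

lemma strictMono_add_sub_le {p : ℤ → ℤ} (hp : StrictMono p) {k l : ℤ} (h : k ≤ l) :
    p k + (l - k) ≤ p l := by
  induction l, h using Int.leInduction with
  | base => simp
  | succ l _ ih => have := hp (show l < l + 1 by omega); omega

lemma strictMono_exists_between {p : ℤ → ℤ} (hp : StrictMono p) (M : ℤ) :
    ∃ k, p k ≤ M ∧ M < p (k + 1) := by
  obtain ⟨k, hk, hmax⟩ := Int.exists_greatest_of_bdd (P := fun k => p k ≤ M)
    ⟨max 0 (M - p 0), fun z hz => by
      rcases le_total 0 z with h | h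
      · have := strictMono_add_sub_le hp h; omega
      · omega⟩
    ⟨min 0 (M - p 0), by
      have := strictMono_add_sub_le hp (show min 0 (M - p 0) ≤ 0 by omega); omega⟩
  refine ⟨k, hk, ?_⟩
  by_contra! h
  have := hmax _ h
  omega

lemma exists_previous_sample {p : ℤ → ℤ} {J : Set ℤ} {e : ℤ} {γ : ℝ} (hp : StrictMono p)
    (hJ : ∀ k, ∃ i ∈ J, p k = 2 * i + e) (hγ : ∀ k, ((p (k + 1) - p k : ℤ) : ℝ) ≤ γ) (j : ℤ) :
    ∃ k : ℕ, j - k ∈ J ∧ (k + 1 : ℝ) ≤ γ / 2 := by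
  obtain ⟨k, hk, hk'⟩ := strictMono_exists_between hp (2 * j + e)
  obtain ⟨i, hi, hpi⟩ := hJ k
  obtain ⟨i', -, hpi'⟩ := hJ (k + 1)
  refine ⟨(j - i).toNat, by rwa [Int.toNat_of_nonneg (by omega), sub_sub_cancel], ?_⟩
  -- The next sample has the same parity and lies strictly above `2j + e`, hence at least two above
  -- it. This is the extra `+ 1` needed to control the profile at `t j + 1`.
  have h1 : (((j - i).toNat : ℤ) + 1) * 2 ≤ p (k + 1) - p k := by omega
  have h2 : ((((j - i).toNat : ℤ) + 1 : ℤ) : ℝ) * 2 ≤ ((p (k + 1) - p k : ℤ) : ℝ) := by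
    exact_mod_cast h1
  have h3 := hγ k
  push_cast at h2 h3
  rw [le_div_iff₀ two_pos]
  linarith

end Gaps

/-! ### Splitting by parity and the sampling theorem -/

lemma hasSum_int_parity {u : ℤ → ℝ} {x y : ℝ} (h0 : HasSum (fun j => u (2 * j + 0)) x)
    (h1 : HasSum (fun j => u (2 * j + 1)) y) : HasSum u (x + y) := by
  have i0 : Function.Injective fun j : ℤ => 2 * j + 0 := fun a b h => by
    simp only at h; omega
  have i1 : Function.Injective fun j : ℤ => 2 * j + 1 := fun a b h => by
    simp only at h; omega
  refine HasSum.add_isCompl (s := Set.range fun j : ℤ => 2 * j + 0)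
    (t := Set.range fun j : ℤ => 2 * j + 1) ?_ (i0.hasSum_range_iff.2 h0) (i1.hasSum_range_iff.2 h1)
  refine ⟨Set.disjoint_left.2 ?_, codisjoint_iff.2 (Set.eq_univ_of_forall fun m => ?_)⟩
  · rintro _ ⟨j, rfl⟩ ⟨k, hk⟩
    simp only at hk
    omega
  · rcases Int.even_or_odd' m with ⟨j, h | h⟩
    · exact Or.inl ⟨j, by simp only; omega⟩
    · exact Or.inr ⟨j, h.symm⟩

lemma tsum_int_parity {u : ℤ → ℝ} (hu : Summable u) :
    ∑' m, u m = ∑' j, u (2 * j + 0) + ∑' j, u (2 * j + 1) := by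
  have i (e : ℤ) : Function.Injective fun j : ℤ => 2 * j + e := fun a b h => by
    simp only at h; omega
  exact (hasSum_int_parity (hu.comp_injective (i 0)).hasSum (hu.comp_injective (i 1)).hasSum).tsum_eq

/-- Sampling on one parity class of the real line. -/
theorem exists_sampling_bound {α : ℝ} (hα0 : 0 < α) (hα : α < Real.pi / 2) {L : Set ℤ} {p : ℤ → ℤ}
    {e : ℤ} (hp : StrictMono p) (hL : ∀ k, ∃ i, 2 * i + e ∈ L ∧ p k = 2 * i + e)
    (hgap : maxGap p < ((Real.pi / α : ℝ) : EReal)) :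
    ∃ c : ℝ, 0 < c ∧ ∀ F ∈ PW α, c * ∑' j : ℤ, ‖F (2 * j + e, 0)‖ ^ 2
      ≤ ∑' j : ℤ, L.indicator (fun m => ‖F (m, 0)‖ ^ 2) (2 * j + e) := by
  obtain ⟨γ, hγ, hγα⟩ := EReal.lt_iff_exists_real_btwn.1 hgap
  have hγα : γ < Real.pi / α := by exact_mod_cast hγα
  have hγk : ∀ k, ((p (k + 1) - p k : ℤ) : ℝ) ≤ γ := fun k => by
    have := (le_iSup (fun k : ℤ => (((p (k + 1) - p k : ℤ) : ℝ) : EReal)) k).trans hγ.le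
    exact_mod_cast this
  set J : Set ℤ := {i | 2 * i + e ∈ L} with hJ
  have hprev := exists_previous_sample (J := J) hp hL hγk
  obtain ⟨t, ht, htJ⟩ := exists_distance hprev
  have hγ2 : 2 ≤ γ := by
    have := ht 0
    have h0 : (0 : ℝ) ≤ t 0 := by positivity
    linarith
  have hπ := Real.pi_pos
  rw [lt_div_iff₀ hα0] at hγα
  -- `θ > 2α` makes the Wirtinger constant exceed the Bernstein constant, while `θ γ / 2 < π` lets
  -- the profile stay positive across a gap; `γ < π / α` makes both possible. The angle left over is
  -- shared equally between the two ends as `η`.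
  obtain ⟨θ, hθ1, hθ2⟩ : ∃ θ, 2 * α < θ ∧ θ < 2 * Real.pi / γ :=
    exists_between (by rw [lt_div_iff₀ (by linarith)]; linarith)
  rw [lt_div_iff₀ (by linarith)] at hθ2
  have hθπ : θ ≤ Real.pi := by nlinarith
  set η := (Real.pi - θ * (γ / 2)) / 2 with hη
  have hη0 : 0 < η := by rw [hη]; linarith
  have hs : 0 < Real.sin η :=
    Real.sin_pos_of_pos_of_lt_pi hη0 (by rw [hη]; nlinarith)
  have hcos : Real.cos θ < 1 - 2 * Real.sin α ^ 2 := by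
    have h1 : Real.cos θ < Real.cos (2 * α) :=
      Real.cos_lt_cos_of_nonneg_of_le_pi (by linarith) hθπ hθ1
    have h2 := Real.cos_two_mul α
    have h3 := Real.sin_sq_add_cos_sq α
    linarith
  set K := 4 + 2 * (Real.sin η)⁻¹ with hK
  have hK0 : 0 < K := by positivity
  refine ⟨(2 - 2 * Real.cos θ - 4 * Real.sin α ^ 2) / K, div_pos (by linarith) hK0, ?_⟩
  intro F hF
  have hinj : Function.Injective fun j : ℤ => 2 * j + e := fun a b h => by
    simp only at h; omega
  have hsum : Summable fun j : ℤ => ‖F (2 * j + e, 0)‖ ^ 2 := hF.2.2.comp_injective hinj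
  have h1 := wirtinger_of_distance hη0 (by linarith : 0 < θ) (Γ := γ / 2) (by rw [hη]; linarith)
    ht htJ (fun j => F (2 * j + e, 0)) hsum
  have h2 := tsum_norm_sq_sub_le_of_mem_PW hα0 hα hF e hsum
  have h3 : (fun j : ℤ => L.indicator (fun m => ‖F (m, 0)‖ ^ 2) (2 * j + e))
      = fun j => J.indicator (fun j => ‖F (2 * j + e, 0)‖ ^ 2) j := rfl
  rw [h3, div_mul_eq_mul_div, div_le_iff₀ hK0]
  linarith

end DiscretePW

theorem mainTheorem2 (α : ℝ) (hα0 : 0 < α) (hα : α < Real.pi / 2)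
    (L : Set ℤ) (p q : ℤ → ℤ)
    (hp : DiscretePW.IsOrderedEnumeration p (L ∩ {m : ℤ | Even m}))
    (hq : DiscretePW.IsOrderedEnumeration q (L ∩ {m : ℤ | Odd m}))
    (hgap : max (DiscretePW.maxGap p) (DiscretePW.maxGap q) < ((Real.pi / α : ℝ) : EReal)) :
    DiscretePW.IsSampling α L := by
  have hpL : ∀ k, ∃ i, 2 * i + 0 ∈ L ∧ p k = 2 * i + 0 := fun k => by
    have hk : p k ∈ L ∩ {m : ℤ | Even m} := hp.2 ▸ Set.mem_range_self k
    obtain ⟨hk, i, hi⟩ := hk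
    have h : p k = 2 * i + 0 := by omega
    exact ⟨i, h ▸ hk, h⟩
  have hqL : ∀ k, ∃ i, 2 * i + 1 ∈ L ∧ q k = 2 * i + 1 := fun k => by
    have hk : q k ∈ L ∩ {m : ℤ | Odd m} := hq.2 ▸ Set.mem_range_self k
    obtain ⟨hk, i, hi⟩ := hk
    exact ⟨i, hi ▸ hk, hi⟩
  obtain ⟨c₀, hc₀, h₀⟩ := DiscretePW.exists_sampling_bound hα0 hα hp.1 hpL
    ((le_max_left _ _).trans_lt hgap)
  obtain ⟨c₁, hc₁, h₁⟩ := DiscretePW.exists_sampling_bound hα0 hα hq.1 hqL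
    ((le_max_right _ _).trans_lt hgap)
  refine ⟨min c₀ c₁, lt_min hc₀ hc₁, fun F hF => ?_⟩
  have hs : Summable fun m : ℤ => ‖F (m, 0)‖ ^ 2 := hF.2.2
  have hnorm : DiscretePW.pwNorm F ^ 2 = ∑' m : ℤ, ‖F (m, 0)‖ ^ 2 :=
    Real.sq_sqrt (tsum_nonneg fun _ => by positivity)
  have hsub : ∑' l : L, ‖F ((l : ℤ), 0)‖ ^ 2 = ∑' m, L.indicator (fun m => ‖F (m, 0)‖ ^ 2) m :=
    tsum_subtype L fun m : ℤ => ‖F (m, 0)‖ ^ 2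
  have hnonneg (e : ℤ) : 0 ≤ ∑' j : ℤ, ‖F (2 * j + e, 0)‖ ^ 2 :=
    tsum_nonneg fun _ => by positivity
  refine ⟨hs.subtype L, ?_, ?_⟩
  · rw [hnorm, hsub, DiscretePW.tsum_int_parity hs, DiscretePW.tsum_int_parity (hs.indicator L),
      mul_add]
    exact add_le_add
      ((mul_le_mul_of_nonneg_right (min_le_left _ _) (hnonneg 0)).trans (h₀ F hF))
      ((mul_le_mul_of_nonneg_right (min_le_right _ _) (hnonneg 1)).trans (h₁ F hF))
  · rw [hnorm]
    exact hs.tsum_subtype_le _ L fun _ => by positivity
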